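/- Let $\rho$ be a two-qubit state, i.e. a positive semidefinite trace-one operator on $\mathbb{C}^2\otimes\mathbb{C}^2$. Let $\sigma_1,\sigma_2,\sigma_3$ be the Pauli matrices, let $x\in\mathbb{R}^3$ be the Bloch vector of the first qubit, $x_j=\operatorname{tr}(\rho\,\sigma_j\otimes I)$, and let $K=(K_{jk})$ be the correlation matrix, $K_{jk}=\operatorname{tr}(\rho\,\sigma_j\otimes\sigma_k)$. The trace-norm geometric discord is $$D_1(\rho)=\min_{P_1,P_2}\ \Big\|\rho-\sum_{k=1}^{2}(P_k\otimes I)\,\rho\,(P_k\otimes I)\Big\|_1,\qquad \|A\|_1=\operatorname{tr}|A|,$$ where the minimum (which is attained in both cases below) is over all pairs of one-dimensional orthogonal projectors on $\mathbb{C}^2$ with $P_1+P_2=I$ and $P_jP_k=\delta_{jk}P_k$. Let $L_-=KK^{T}-W_x$ with $W_x z=\langle z,x\rangle x$, let $\hat\lambda_1\ge\hat\lambda_2\ge\hat\lambda_3$ be the eigenvalues of $L_-$ counted with multiplicity, and let $x_1=\langle e_1,x\rangle$ be the first component of the Bloch vector with respect to an orthonormal basis $(e_1,e_2,e_3)$ of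 $\mathbb{R}^3$ with $L_-e_i=\hat\lambda_i e_i$. Suppose that the spectrum of $L_-$ is degenerate. 1. If $\hat\lambda_1=\hat\lambda_2\ge\hat\lambda_3$, then $D_1(\rho)=\sqrt{\hat\lambda_2}$. 2. If $\hat\lambda_1>\hat\lambda_2=\hat\lambda_3$, then $$D_1(\rho)=\frac{1}{\sqrt2}\sqrt{\hat\lambda_1+\hat\lambda_2+\|x\|^2-\sqrt{(\hat\lambda_1-\hat\lambda_2-\|x\|^2)^2+4(\hat\lambda_1-\hat\lambda_2)\,x_1^2}}\,.$$ -/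

import Mathlib

open scoped Kronecker ComplexOrder MatrixOrder

namespace TwoQubit

noncomputable section

/-- The Pauli matrices `σ₁, σ₂, σ₃` (indexed by `0, 1, 2`). -/
def pauli : Fin 3 → Matrix (Fin 2) (Fin 2) ℂ :=
  ![!![0, 1; 1, 0], !![0, -Complex.I; Complex.I, 0], !![1, 0; 0, -1]]

/-- Operators on `ℂ² ⊗ ℂ²`; the first index is that of subsystem `A`, the second that of `B`. -/
abbrev Op : Type := Matrix (Fin 2 × Fin 2) (Fin 2 × Fin 2) ℂ

/-- Two-qubit states: positive semidefinite matrices of trace one. -/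
structure IsState (ρ : Op) : Prop where
  posSemidef : ρ.PosSemidef
  trace_eq_one : ρ.trace = 1

/-- The Bloch vector of the marginal on `A`: `x_j = tr (ρ (σ_j ⊗ 1))`. -/
def blochA (ρ : Op) : EuclideanSpace ℝ (Fin 3) :=
  WithLp.toLp 2 fun j => ((ρ * (pauli j ⊗ₖ (1 : Matrix (Fin 2) (Fin 2) ℂ))).trace).re

/-- The correlation matrix: `K_{jk} = tr (ρ (σ_j ⊗ σ_k))`. -/
def corr (ρ : Op) : Matrix (Fin 3) (Fin 3) ℝ :=
  Matrix.of fun j k => ((ρ * (pauli j ⊗ₖ pauli k)).trace).re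

/-- The matrix `L₋ = K Kᵀ - W_x`, where `W_x z = ⟨z, x⟩ x`, i.e. `W_x = x xᵀ`. -/
def Lminus (ρ : Op) : Matrix (Fin 3) (Fin 3) ℝ :=
  corr ρ * (corr ρ).transpose - Matrix.vecMulVec (blochA ρ) (blochA ρ)

/-- A projective measurement on a qubit: `P 0, P 1` are one-dimensional orthogonal projectors
on `ℂ²` with `P 0 + P 1 = 1` and `P j * P k = δ_{jk} P k`. -/
structure IsProjMeasurement (P : Fin 2 → Matrix (Fin 2) (Fin 2) ℂ) : Prop where
  isHermitian : ∀ k, (P k).IsHermitian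
  rank_eq_one : ∀ k, (P k).rank = 1
  mul_eq : ∀ j k, P j * P k = if j = k then P k else 0
  sum_eq_one : P 0 + P 1 = 1

/-- The local measurement `ℙ_A = ℙ ⊗ id` on subsystem `A`, where `ℙ(X) = ∑ₖ Pₖ X Pₖ`. -/
def measureA (P : Fin 2 → Matrix (Fin 2) (Fin 2) ℂ) (ρ : Op) : Op :=
  ∑ k, (P k ⊗ₖ (1 : Matrix (Fin 2) (Fin 2) ℂ)) * ρ * (P k ⊗ₖ (1 : Matrix (Fin 2) (Fin 2) ℂ))

/-- The trace norm `‖A‖₁ = tr |A|`, with `|A| = √(A* A)`. -/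
def traceNorm (A : Op) : ℝ := ((CFC.abs A).trace).re

/-- The set of all disturbances `‖ρ - ℙ_A(ρ)‖₁` of `ρ` by projective measurements on `A`. -/
def disturbances (ρ : Op) : Set ℝ :=
  {d | ∃ P, IsProjMeasurement P ∧ d = traceNorm (ρ - measureA P ρ)}

/-- The trace-norm geometric discord `D₁(ρ)`: the least disturbance (written as an infimum;
it is a minimum when `IsLeast (disturbances ρ) (discord ρ)`). -/
def discord (ρ : Op) : ℝ := sInf (disturbances ρ)

end

end TwoQubit

/-! A projective qubit measurement is a unit Bloch direction `n`. It keeps the part of the Bloch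
expansion of `ρ` along `1` and `n` and deletes the part orthogonal to `n`, so the disturbance is the
trace norm of `¼ (S ⊗ A + T ⊗ C)`, with `S`, `T` the anticommuting spins of an orthonormal basis of
`n^⊥`. The square of such an operator has two doubly degenerate eigenvalues, so its trace norm is
explicit (`traceNorm_of_anticommute`). The squared disturbance is the larger eigenvalue of `L₋`
compressed to `n^⊥`, plus `‖x‖² - ⟨n, x⟩²`. Degeneracy means `L₋ = α + β |f⟩⟨f|`; the compression
then has eigenvalue gap `|β| (1 - ⟨f, n⟩²)` and the inner root disappears
(`traceNorm_sub_measureA`). If `β ≤ 0`, only `-⟨n, x⟩²` depends on `n`, and `n` parallel to `x` is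
optimal. If `β > 0`, one maximises the rank-two form `β ⟨f, n⟩² + ⟨n, x⟩²`, a two-dimensional
eigenvalue problem (`exists_max_rank_two`). -/

namespace TwoQubit

/-! ### Pauli algebra -/

/-- The spin observable `z · σ = ∑ⱼ zⱼ σⱼ` in direction `z`. -/
noncomputable def spin (z : EuclideanSpace ℝ (Fin 3)) : Matrix (Fin 2) (Fin 2) ℂ :=
  ∑ j, (z j : ℂ) • pauli j

theorem spin_eq (z : EuclideanSpace ℝ (Fin 3)) :
    spin z = !![(z 2 : ℂ), z 0 - z 1 * Complex.I; z 0 + z 1 * Complex.I, -z 2] := by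
  ext i j
  fin_cases i <;> fin_cases j <;> simp [spin, pauli, Fin.sum_univ_three]
  ring

theorem spin_mul_add_mul (u v : EuclideanSpace ℝ (Fin 3)) :
    spin u * spin v + spin v * spin u = ((2 * inner ℝ u v : ℝ) : ℂ) • 1 := by
  have hI := Complex.I_sq
  ext i j
  fin_cases i <;> fin_cases j <;>
    simp [spin_eq, PiLp.inner_apply, Fin.sum_univ_three] <;>
    ring_nf <;> simp only [hI] <;> ring

theorem spin_mul_self (u : EuclideanSpace ℝ (Fin 3)) :
    spin u * spin u = ((inner ℝ u u : ℝ) : ℂ) • 1 := by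
  have h := spin_mul_add_mul u u
  ext i j
  have := congrFun (congrFun h i) j
  simp only [Matrix.add_apply, Matrix.smul_apply, smul_eq_mul] at this ⊢
  push_cast at this ⊢
  linear_combination this / 2

theorem spin_isHermitian (u : EuclideanSpace ℝ (Fin 3)) : (spin u).IsHermitian := by
  ext i j
  fin_cases i <;> fin_cases j <;> simp [spin_eq]
  ring

/-! ### Trace norm of a sum of two anticommuting terms -/

/-- Polynomial identities between two traceless `2 × 2` matrices shifted by scalars. -/
theorem traceless_identities {R : Type*} [CommRing R] (a₀ c₀ p₁ p₂ p₃ q₁ q₂ q₃ s D : R)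
    (A C W V : Matrix (Fin 2) (Fin 2) R)
    (hA : A = a₀ • 1 + !![p₁, p₂; p₃, -p₁]) (hC : C = c₀ • 1 + !![q₁, q₂; q₃, -q₁])
    (hs : s = a₀ ^ 2 + c₀ ^ 2 + (p₁ ^ 2 + p₂ * p₃) + (q₁ ^ 2 + q₂ * q₃))
    (hD : D = ((p₁ ^ 2 + p₂ * p₃ - a₀ ^ 2) - (q₁ ^ 2 + q₂ * q₃ - c₀ ^ 2)) ^ 2
      + (2 * p₁ * q₁ + p₂ * q₃ + p₃ * q₂ - 2 * a₀ * c₀) ^ 2)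
    (hW : W = A * A + C * C - s • 1) (hV : V = A * C - C * A) :
    W.trace = 0 ∧ V.trace = 0 ∧ W * V + V * W = 0 ∧ W * W - V * V = (s ^ 2 - D) • 1 := by
  -- As vectors, `W` is `2 (a₀ p + c₀ q)` and `V` is proportional to the cross product of `p` and
  -- `q`. They are orthogonal, hence `W` and `V` anticommute.
  have hW' : W = !![2 * a₀ * p₁ + 2 * c₀ * q₁, 2 * a₀ * p₂ + 2 * c₀ * q₂;
      2 * a₀ * p₃ + 2 * c₀ * q₃, -(2 * a₀ * p₁ + 2 * c₀ * q₁)] := by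
    ext i j
    fin_cases i <;> fin_cases j <;> (simp [hW, hA, hC, hs, Matrix.mul_apply]; ring)
  have hV' : V = !![p₂ * q₃ - q₂ * p₃, 2 * p₁ * q₂ - 2 * p₂ * q₁;
      2 * p₃ * q₁ - 2 * p₁ * q₃, -(p₂ * q₃ - q₂ * p₃)] := by
    ext i j
    fin_cases i <;> fin_cases j <;> (simp [hV, hA, hC, Matrix.mul_apply]; ring)
  refine ⟨?_, ?_, ?_, ?_⟩
  · simp [hW', Matrix.trace_fin_two]
  · simp [hV', Matrix.trace_fin_two]
  · ext i j
    fin_cases i <;> fin_cases j <;> (simp [hW', hV']; ring)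
  · ext i j
    fin_cases i <;> fin_cases j <;> (simp [hW', hV', hs, hD]; ring)

/-- If `Q²` has eigenvalues `μ²`, `ν²`, each twice, then `t = μ² + ν²` and `δ = μν`, so `μ + ν = √(t
+ 2δ)`. Cayley–Hamilton for `|Q|` gives `|Q| = (Q² + δ) / (μ + ν)`, whose trace is `2 (μ + ν)`. -/
theorem traceNorm_eq_of_quartic {Q : Op} (hQ : Q.IsHermitian) {t δ : ℝ} (ht : 0 ≤ t) (hδ : 0 ≤ δ)
    (htr : (Q * Q).trace = ((2 * t : ℝ) : ℂ))
    (h4 : Q * Q * (Q * Q) = (t : ℂ) • (Q * Q) - ((δ ^ 2 : ℝ) : ℂ) • 1) :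
    traceNorm Q = 2 * √(t + 2 * δ) := by
  have hsq : star Q * Q = Q * Q := by rw [Matrix.star_eq_conjTranspose, hQ.eq]
  -- The formula for `|Q|` divides by `√(t + 2δ)`; if that vanishes, `Q = 0`.
  rcases eq_or_lt_of_le (show 0 ≤ t + 2 * δ by positivity) with h0 | h0
  · have ht0 : t = 0 := by linarith
    have hQ0 : Q = 0 := by
      rw [← Matrix.trace_conjTranspose_mul_self_eq_zero_iff, hQ.eq, htr, ht0]; simp
    rw [← h0, hQ0]
    simp [traceNorm]
  · set c := √(t + 2 * δ) with hc
    have hc0 : 0 < c := Real.sqrt_pos.2 h0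
    have hcc : c ^ 2 = t + 2 * δ := Real.sq_sqrt h0.le
    have hcc' : (c : ℂ) ^ 2 = t + 2 * δ := by exact_mod_cast hcc
    have hcne : (c : ℂ) ≠ 0 := by exact_mod_cast hc0.ne'
    have habs : CFC.abs Q = ((c⁻¹ : ℝ) : ℂ) • (Q * Q + (δ : ℂ) • 1) := by
      rw [CFC.abs, hsq]
      apply CFC.sqrt_unique
      · simp only [add_mul, mul_add, h4, smul_mul_assoc, mul_smul_comm,
          one_mul, mul_one]
        ext i j
        simp only [Matrix.smul_apply, Matrix.add_apply, Matrix.sub_apply, smul_eq_mul]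
        push_cast
        field_simp
        linear_combination (-(Q * Q) i j) * hcc'
      · rw [Matrix.nonneg_iff_posSemidef]
        apply Matrix.PosSemidef.smul
        · apply Matrix.PosSemidef.add
          · have := Matrix.posSemidef_conjTranspose_mul_self Q
            rwa [hQ.eq] at this
          · exact Matrix.PosSemidef.one.smul (by exact_mod_cast hδ)
        · exact_mod_cast (inv_pos.2 hc0).le
    rw [traceNorm, habs, Matrix.trace_smul, Matrix.trace_add, htr, Matrix.trace_smul,
      Matrix.trace_one]
    simp only [Fintype.card_prod, Fintype.card_fin, smul_eq_mul]
    rw [show ((c⁻¹ : ℝ) : ℂ) * (((2 * t : ℝ) : ℂ) + (δ : ℂ) * ((2 * 2 : ℕ) : ℂ)) =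
      ((c⁻¹ * (2 * t + δ * 4) : ℝ) : ℂ) by push_cast; ring, Complex.ofReal_re]
    field_simp
    linarith

open Matrix

/-- Trace norm of `¼ (S ⊗ (a₀ + a·σ) + T ⊗ (c₀ + c·σ))` for anticommuting Hermitian
involutions `S, T`. -/
theorem traceNorm_of_anticommute {S T : Matrix (Fin 2) (Fin 2) ℂ} (hS : S.IsHermitian)
    (hT : T.IsHermitian) (hSS : S * S = 1) (hTT : T * T = 1) (hST : T * S = -(S * T))
    (a₀ c₀ : ℝ) (a c : EuclideanSpace ℝ (Fin 3)) :
    traceNorm ((1 / 4 : ℂ) • (S ⊗ₖ ((a₀ : ℂ) • 1 + spin a) + T ⊗ₖ ((c₀ : ℂ) • 1 + spin c))) =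
      √((a₀ ^ 2 + c₀ ^ 2 + inner ℝ a a + inner ℝ c c
        + √(((inner ℝ a a - a₀ ^ 2) - (inner ℝ c c - c₀ ^ 2)) ^ 2
          + 4 * (inner ℝ a c - a₀ * c₀) ^ 2)) / 2) := by
  set A := (a₀ : ℂ) • 1 + spin a with hA
  set C := (c₀ : ℂ) • 1 + spin c with hC
  set s := a₀ ^ 2 + c₀ ^ 2 + inner ℝ a a + inner ℝ c c with hs
  set D := ((inner ℝ a a - a₀ ^ 2) - (inner ℝ c c - c₀ ^ 2)) ^ 2
          + 4 * (inner ℝ a c - a₀ * c₀) ^ 2 with hD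
  have haa : (0 : ℝ) ≤ inner ℝ a a := real_inner_self_nonneg
  have hcc : (0 : ℝ) ≤ inner ℝ c c := real_inner_self_nonneg
  have hs0 : 0 ≤ s := by positivity
  have hD0 : 0 ≤ D := by positivity
  set W := A * A + C * C - (s : ℂ) • 1 with hW
  set V := A * C - C * A with hV
  set Q := (1 / 4 : ℂ) • (S ⊗ₖ A + T ⊗ₖ C) with hQ
  have hinner : ∀ u v : EuclideanSpace ℝ (Fin 3), ((2 * inner ℝ u v : ℝ) : ℂ) =
      2 * spin u 0 0 * spin v 0 0 + spin u 0 1 * spin v 1 0 + spin u 1 0 * spin v 0 1 := by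
    intro u v
    have := congrFun (congrFun (spin_mul_add_mul u v) 0) 0
    simp only [Matrix.add_apply, Matrix.mul_apply, Fin.sum_univ_two, Matrix.smul_apply,
      Matrix.one_apply_eq, smul_eq_mul, mul_one] at this
    linear_combination -this
  have hspin : ∀ u : EuclideanSpace ℝ (Fin 3),
      spin u = !![spin u 0 0, spin u 0 1; spin u 1 0, -spin u 0 0] := by
    intro u
    ext i j
    fin_cases i <;> fin_cases j <;> simp [spin_eq]
  obtain ⟨hWtr, hVtr, hWV, hWWVV⟩ := traceless_identities (a₀ : ℂ) c₀ _ _ _ _ _ _ (s : ℂ) (D : ℂ)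
    A C W V (hA.trans (by rw [← hspin a])) (hC.trans (by rw [← hspin c]))
    (by
      have h1 := hinner a a
      have h2 := hinner c c
      rw [hs]
      push_cast at h1 h2 ⊢
      linear_combination h1 / 2 + h2 / 2)
    (by
      have h1 := hinner a a
      have h2 := hinner c c
      have h3 := hinner a c
      have e1 : ((inner ℝ a a : ℝ) : ℂ) = spin a 0 0 ^ 2 + spin a 0 1 * spin a 1 0 := by
        push_cast at h1; linear_combination h1 / 2
      have e2 : ((inner ℝ c c : ℝ) : ℂ) = spin c 0 0 ^ 2 + spin c 0 1 * spin c 1 0 := by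
        push_cast at h2; linear_combination h2 / 2
      push_cast at h3
      rw [hD]
      push_cast
      rw [e1, e2, ← h3]
      ring)
    hW hV
  have hAh : A.IsHermitian := by
    rw [Matrix.IsHermitian, hA, conjTranspose_add, conjTranspose_smul, (spin_isHermitian a).eq]
    simp
  have hCh : C.IsHermitian := by
    rw [Matrix.IsHermitian, hC, conjTranspose_add, conjTranspose_smul, (spin_isHermitian c).eq]
    simp
  have hQh : Q.IsHermitian := by
    rw [Matrix.IsHermitian, hQ, conjTranspose_smul, conjTranspose_add, conjTranspose_kronecker,
      conjTranspose_kronecker, hAh.eq, hCh.eq, hS.eq, hT.eq]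
    simp
  -- `Z` is the traceless part of `16 Q²`. Its square is a scalar because `(S * T)² = -1` and `W`,
  -- `V` anticommute.
  set Z := (1 : Matrix (Fin 2) (Fin 2) ℂ) ⊗ₖ W + (S * T) ⊗ₖ V with hZ
  have hQQ : Q * Q = (1 / 16 : ℂ) • ((s : ℂ) • 1 + Z) := by
    have h1 : A * A + C * C = (s : ℂ) • 1 + W := by rw [hW]; abel
    have h2 : (S ⊗ₖ A + T ⊗ₖ C) * (S ⊗ₖ A + T ⊗ₖ C) = (s : ℂ) • 1 + Z := by
      simp only [mul_add, add_mul, ← mul_kronecker_mul, hSS, hTT, hST]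
      have h3 : (1 : Matrix (Fin 2) (Fin 2) ℂ) ⊗ₖ ((s : ℂ) • 1) + 1 ⊗ₖ W =
          1 ⊗ₖ (A * A) + 1 ⊗ₖ (C * C) := by
        rw [← kronecker_add, ← h1, kronecker_add]
      rw [hZ, ← one_kronecker_one, ← kronecker_smul, hV,
        ← add_assoc (1 ⊗ₖ ((s : ℂ) • (1 : Matrix (Fin 2) (Fin 2) ℂ))), h3]
      ext ⟨i, j⟩ ⟨k, l⟩
      simp only [Matrix.add_apply, kroneckerMap_apply, Matrix.sub_apply, Matrix.neg_apply]
      ring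
    rw [hQ, smul_mul_smul_comm, h2]; norm_num
  have hJJ : S * T * (S * T) = -1 := by
    rw [mul_assoc, ← mul_assoc T, hST]; simp [mul_assoc, hTT, hSS]
  have hZZ : Z * Z = ((s ^ 2 - D : ℝ) : ℂ) • 1 := by
    have h1 : Z * Z = 1 ⊗ₖ (W * W - V * V) + (S * T) ⊗ₖ (W * V + V * W) := by
      simp only [hZ, mul_add, add_mul, ← mul_kronecker_mul, hJJ, one_mul, mul_one]
      ext ⟨i, j⟩ ⟨k, l⟩
      simp only [Matrix.add_apply, kroneckerMap_apply, Matrix.sub_apply, Matrix.neg_apply]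
      ring
    rw [h1, hWV, hWWVV, kronecker_zero, add_zero, kronecker_smul, one_kronecker_one]
    push_cast
    rfl
  have htrZ : Z.trace = 0 := by
    rw [hZ, trace_add, trace_kronecker, trace_kronecker, hWtr, hVtr]
    simp
  rw [traceNorm_eq_of_quartic (t := s / 8) (δ := √D / 16) hQh (by positivity) (by positivity)]
  · rw [show (s + √D) / 2 = 2 ^ 2 * (s / 8 + 2 * (√D / 16)) by ring,
      Real.sqrt_mul (by norm_num), Real.sqrt_sq (by norm_num)]
  · rw [hQQ]
    simp [htrZ]
    ring
  · rw [hQQ, div_pow, Real.sq_sqrt hD0]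
    simp only [mul_add, add_mul, hZZ, mul_one, one_mul, smul_mul_assoc,
      mul_smul_comm]
    ext i j
    simp only [Matrix.smul_apply, Matrix.add_apply, Matrix.sub_apply, smul_eq_mul]
    push_cast
    ring

/-! ### Bloch expansion and the effect of a measurement -/

/-- The correlation vector `Kᵀ z`. -/
noncomputable def corrVec (ρ : Op) (z : EuclideanSpace ℝ (Fin 3)) : EuclideanSpace ℝ (Fin 3) :=
  WithLp.toLp 2 ((corr ρ)ᵀ *ᵥ z)

/-- The operator on `B` that multiplies `z · σ` in the Bloch expansion of `ρ`. -/
noncomputable def coeffB (ρ : Op) (z : EuclideanSpace ℝ (Fin 3)) : Matrix (Fin 2) (Fin 2) ℂ :=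
  ((inner ℝ z (blochA ρ) : ℝ) : ℂ) • 1 + spin (corrVec ρ z)

theorem pauli_isHermitian (j : Fin 3) : (pauli j).IsHermitian := by
  ext i k
  fin_cases j <;> fin_cases i <;> fin_cases k <;> simp [pauli]

theorem ofReal_trace_mul_re {A B : Op} (hA : A.IsHermitian) (hB : B.IsHermitian) :
    (((A * B).trace.re : ℝ) : ℂ) = (A * B).trace := by
  rw [← Complex.conj_eq_iff_re, ← Complex.star_def, ← trace_conjTranspose, conjTranspose_mul,
    hA.eq, hB.eq, trace_mul_comm]

theorem pauli_expansion (M : Matrix (Fin 2) (Fin 2) ℂ) :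
    M = (1 / 2 : ℂ) • (M.trace • 1 + ∑ j, (M * pauli j).trace • pauli j) := by
  ext i k
  simp only [Matrix.smul_apply, Matrix.add_apply, Fin.sum_univ_three, smul_eq_mul,
    trace_fin_two, mul_apply, Fin.sum_univ_two]
  fin_cases i <;> fin_cases k <;> simp [pauli] <;> ring_nf <;> simp only [Complex.I_sq] <;> ring

/-- The partial trace of `ρ (X ⊗ 1)` over `A`. -/
def partialTrace (ρ : Op) (X : Matrix (Fin 2) (Fin 2) ℂ) : Matrix (Fin 2) (Fin 2) ℂ :=
  of fun j l => ∑ i, ∑ k, ρ (i, j) (k, l) * X k i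

theorem trace_mul_kronecker (ρ : Op) (X Z : Matrix (Fin 2) (Fin 2) ℂ) :
    (ρ * (X ⊗ₖ Z)).trace = (partialTrace ρ X * Z).trace := by
  simp only [trace, diag_apply, mul_apply, Fintype.sum_prod_type, Fin.sum_univ_two,
    kroneckerMap_apply, partialTrace, of_apply]
  ring

/-- `Y` is left unspecified because its term commutes with every local measurement on `A` and
cancels from the disturbance. -/
theorem bloch_expansion {ρ : Op} (hρ : ρ.IsHermitian) :
    ∃ Y : Matrix (Fin 2) (Fin 2) ℂ, ρ = (1 / 4 : ℂ) • (1 ⊗ₖ Y +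
      ∑ j, pauli j ⊗ₖ coeffB ρ (EuclideanSpace.single j 1)) := by
  refine ⟨(2 : ℂ) • partialTrace ρ 1, ?_⟩
  have hx : ∀ j, ((blochA ρ j : ℝ) : ℂ) = (ρ * (pauli j ⊗ₖ 1)).trace := fun j =>
    ofReal_trace_mul_re hρ (by rw [IsHermitian, conjTranspose_kronecker, (pauli_isHermitian j).eq,
      conjTranspose_one])
  have hK : ∀ j k, ((corr ρ j k : ℝ) : ℂ) = (ρ * (pauli j ⊗ₖ pauli k)).trace := fun j k =>
    ofReal_trace_mul_re hρ (by rw [IsHermitian, conjTranspose_kronecker, (pauli_isHermitian j).eq,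
      (pauli_isHermitian k).eq])
  have hc : ∀ j, coeffB ρ (EuclideanSpace.single j 1) = (ρ * (pauli j ⊗ₖ 1)).trace • 1 +
      ∑ k, (ρ * (pauli j ⊗ₖ pauli k)).trace • pauli k := by
    intro j
    simp [coeffB, spin, ← hx, ← hK, corrVec, EuclideanSpace.inner_single_left]
  have hp : ∀ j, coeffB ρ (EuclideanSpace.single j 1) = (2 : ℂ) • partialTrace ρ (pauli j) := by
    intro j
    rw [hc]
    conv_rhs => rw [pauli_expansion (partialTrace ρ (pauli j))]
    simp_rw [trace_mul_kronecker, mul_one, smul_smul]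
    norm_num
  simp_rw [hp]
  ext ⟨i, j⟩ ⟨k, l⟩
  simp only [Matrix.smul_apply, Matrix.add_apply, kroneckerMap_apply,
    Fin.sum_univ_three, smul_eq_mul, partialTrace, of_apply, Fin.sum_univ_two]
  fin_cases i <;> fin_cases k <;> simp [pauli] <;> ring_nf <;> simp only [Complex.I_sq] <;> ring

/-- Both factors are linear in the direction, so the sum is a contraction with the identity tensor
and does not depend on the orthonormal basis. -/
theorem sum_spin_kronecker {ρ : Op} (b : OrthonormalBasis (Fin 3) ℝ (EuclideanSpace ℝ (Fin 3))) :
    ∑ j, pauli j ⊗ₖ coeffB ρ (EuclideanSpace.single j 1) =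
      ∑ i, spin (b i) ⊗ₖ coeffB ρ (b i) := by
  have hc : ∀ z, coeffB ρ z = ∑ j, (z j : ℂ) • coeffB ρ (EuclideanSpace.single j 1) := by
    intro z
    ext i j
    fin_cases i <;> fin_cases j <;> (simp [coeffB, corrVec, spin_eq,
      Fin.sum_univ_three, PiLp.inner_apply, mulVec, dotProduct]; ring)
  have hb : ∀ j k, ∑ i, (b i j : ℂ) * b i k = if j = k then 1 else 0 := by
    intro j k
    have := b.sum_inner_mul_inner (EuclideanSpace.single j 1) (EuclideanSpace.single k 1)
    simp only [EuclideanSpace.inner_single_left, EuclideanSpace.inner_single_right, map_one,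
      one_mul, conj_trivial, PiLp.single_apply, eq_comm (a := k)] at this
    have := congrArg Complex.ofReal this
    rw [apply_ite Complex.ofReal] at this
    simpa using this
  have h : ∀ i, spin (b i) ⊗ₖ coeffB ρ (b i) = ∑ j, ∑ k, ((b i j : ℂ) * b i k) •
      pauli j ⊗ₖ coeffB ρ (EuclideanSpace.single k 1) := by
    intro i
    rw [hc (b i), spin]
    ext ⟨p, q⟩ ⟨r, s⟩
    simp [Fin.sum_univ_three, kroneckerMap_apply]
    ring
  simp_rw [h]
  rw [Finset.sum_comm]
  refine Finset.sum_congr rfl fun j _ => ?_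
  rw [Finset.sum_comm]
  simp_rw [← Finset.sum_smul, hb]
  simp

/-- The change of `ρ` under the measurement along the last vector of an orthonormal basis. -/
theorem sub_measureA {ρ : Op} (hρ : ρ.IsHermitian)
    (b : OrthonormalBasis (Fin 3) ℝ (EuclideanSpace ℝ (Fin 3)))
    (P : Fin 2 → Matrix (Fin 2) (Fin 2) ℂ) (hP0 : P 0 = (1 / 2 : ℂ) • (1 + spin (b 2)))
    (hP1 : P 1 = (1 / 2 : ℂ) • (1 - spin (b 2))) :
    ρ - measureA P ρ = (1 / 4 : ℂ) •
      (spin (b 0) ⊗ₖ coeffB ρ (b 0) + spin (b 1) ⊗ₖ coeffB ρ (b 1)) := by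
  obtain ⟨Y, hY⟩ := bloch_expansion hρ
  rw [sum_spin_kronecker b, Fin.sum_univ_three] at hY
  set N := spin (b 2) ⊗ₖ (1 : Matrix (Fin 2) (Fin 2) ℂ) with hN
  -- The measurement averages `ρ` with its conjugate by `N`. That conjugation flips the sign of the
  -- spins orthogonal to `b 2` and fixes the rest.
  have h1 : measureA P ρ = (1 / 2 : ℂ) • (ρ + N * ρ * N) := by
    have e0 : P 0 ⊗ₖ (1 : Matrix (Fin 2) (Fin 2) ℂ) = (1 / 2 : ℂ) • (1 + N) := by
      rw [hP0, smul_kronecker, add_kronecker, one_kronecker_one]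
    have e1 : P 1 ⊗ₖ (1 : Matrix (Fin 2) (Fin 2) ℂ) = (1 / 2 : ℂ) • (1 - N) := by
      rw [hP1, smul_kronecker, sub_eq_add_neg, add_kronecker, one_kronecker_one,
        sub_eq_add_neg, hN, ← neg_one_smul ℂ, smul_kronecker, neg_one_smul]
    rw [measureA, Fin.sum_univ_two, e0, e1]
    simp only [smul_mul_assoc, mul_smul_comm, add_mul, mul_add, sub_mul, mul_sub, one_mul, mul_one]
    module
  have hnn : spin (b 2) * spin (b 2) = 1 := by
    rw [spin_mul_self]; simp
  have hu : ∀ i, i ≠ 2 → spin (b 2) * spin (b i) * spin (b 2) = -spin (b i) := by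
    intro i hi
    have := spin_mul_add_mul (b 2) (b i)
    rw [b.inner_eq_zero hi.symm] at this
    rw [show spin (b 2) * spin (b i) = -(spin (b i) * spin (b 2)) from
      eq_neg_of_add_eq_zero_left (by simpa using this), neg_mul, mul_assoc, hnn, mul_one]
  have h2 : N * ρ * N = (1 / 4 : ℂ) • (1 ⊗ₖ Y + (-(spin (b 0) ⊗ₖ coeffB ρ (b 0)) -
      spin (b 1) ⊗ₖ coeffB ρ (b 1) + spin (b 2) ⊗ₖ coeffB ρ (b 2))) := by
    conv_lhs => rw [hY]
    simp only [hN, smul_mul_assoc, mul_smul_comm, add_mul, mul_add, ← mul_kronecker_mul,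
      one_mul, mul_one, hnn, hu 0 (by decide), hu 1 (by decide)]
    simp only [← neg_one_smul ℂ (spin _), smul_kronecker]
    module
  rw [h1, h2]
  nth_rw 1 2 [hY]
  module

/-! ### Projective measurements as Bloch directions -/

/-- The projective measurement along the direction `n` of the Bloch sphere. -/
noncomputable def spinMeasurement (n : EuclideanSpace ℝ (Fin 3)) :
    Fin 2 → Matrix (Fin 2) (Fin 2) ℂ :=
  ![(1 / 2 : ℂ) • (1 + spin n), (1 / 2 : ℂ) • (1 - spin n)]

theorem rank_eq_one_of_det_eq_zero {M : Matrix (Fin 2) (Fin 2) ℂ} (h : M.det = 0) (hM : M ≠ 0) :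
    M.rank = 1 := by
  obtain ⟨v, hv, hMv⟩ := Matrix.exists_mulVec_eq_zero_iff.2 h
  have hrn := LinearMap.finrank_range_add_finrank_ker M.mulVecLin
  have hker : 0 < Module.finrank ℂ (LinearMap.ker M.mulVecLin) :=
    Module.finrank_pos_iff_exists_ne_zero.2 ⟨⟨v, by simpa using hMv⟩, by simpa using hv⟩
  have hrange : 0 < Module.finrank ℂ (LinearMap.range M.mulVecLin) := by
    rw [Nat.pos_iff_ne_zero, ne_eq, Submodule.finrank_eq_zero, LinearMap.range_eq_bot]
    intro h0
    apply hM
    exact mulVec_injective (funext fun w => by simpa using LinearMap.congr_fun h0 w)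
  rw [Matrix.rank]
  simp only [Module.finrank_fintype_fun_eq_card, Fintype.card_fin] at hrn
  omega

theorem spinMeasurement_isProjMeasurement {n : EuclideanSpace ℝ (Fin 3)} (hn : ‖n‖ = 1) :
    IsProjMeasurement (spinMeasurement n) := by
  have hnn : spin n * spin n = 1 := by
    rw [spin_mul_self, real_inner_self_eq_norm_sq, hn]; simp
  have hsum : spinMeasurement n 0 + spinMeasurement n 1 = 1 := by
    simp only [spinMeasurement, cons_val_zero, cons_val_one]
    module
  have hdet : ∀ k, (spinMeasurement n k).det = 0 := by
    have h := congrFun (congrFun hnn 0) 0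
    simp [mul_apply, spin_eq] at h
    intro k
    fin_cases k <;> simp [spinMeasurement, det_fin_two, spin_eq] <;>
      first | linear_combination -h / 4 | linear_combination -h
  have htr : ∀ k, (spinMeasurement n k).trace = 1 := by
    intro k
    fin_cases k <;> simp [spinMeasurement, trace_fin_two, spin_eq]
  have hrank : ∀ k, (spinMeasurement n k).rank = 1 := fun k =>
    rank_eq_one_of_det_eq_zero (hdet k) fun h => by simpa [h] using htr k
  refine ⟨?_, hrank, ?_, hsum⟩
  · intro k
    fin_cases k <;> simp [spinMeasurement, IsHermitian, (spin_isHermitian n).eq]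
  · intro j k
    fin_cases j <;> fin_cases k <;>
      simp [spinMeasurement, mul_add, add_mul, mul_sub, sub_mul, hnn] <;> module

theorem IsProjMeasurement.exists_eq_spinMeasurement {P : Fin 2 → Matrix (Fin 2) (Fin 2) ℂ}
    (hP : IsProjMeasurement P) :
    ∃ n : EuclideanSpace ℝ (Fin 3), ‖n‖ = 1 ∧ P = spinMeasurement n := by
  have hH := hP.isHermitian 0
  have hid : P 0 * P 0 = P 0 := by simpa using hP.mul_eq 0 0
  have hne : P 0 ≠ 0 := fun h => by simpa [h] using hP.rank_eq_one 0
  have hdet : (P 0).det = 0 := by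
    by_contra hd
    have := rank_of_isUnit (P 0) ((isUnit_iff_isUnit_det _).2 (isUnit_iff_ne_zero.2 hd))
    rw [hP.rank_eq_one 0] at this
    simp at this
  have htr : (P 0).trace = 1 := by
    -- Cayley–Hamilton with zero determinant; comparison with `P 0 * P 0 = P 0` forces trace one.
    have hch : P 0 * P 0 = (P 0).trace • P 0 := by
      rw [det_fin_two] at hdet
      ext i j
      fin_cases i <;> fin_cases j <;> simp [mul_apply, trace_fin_two] <;>
        first | linear_combination -hdet | ring
    rw [hid] at hch
    by_contra h
    apply hne
    have : (1 - (P 0).trace) • P 0 = 0 := by rw [sub_smul, one_smul, ← hch, sub_self]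
    exact (smul_eq_zero.1 this).resolve_left (sub_ne_zero.2 (Ne.symm h))
  set a := P 0 0 0 with ha
  set w := P 0 1 0 with hw
  have har : (a.re : ℂ) = a := Complex.conj_eq_iff_re.1 (hH.apply 0 0)
  have h01 : P 0 0 1 = (starRingEnd ℂ) w := (hH.apply 0 1).symm
  have h11 : P 0 1 1 = 1 - a := by rw [trace_fin_two] at htr; linear_combination htr
  have hP0 : P 0 = (1 / 2 : ℂ) • (1 + spin (WithLp.toLp 2 ![2 * w.re, 2 * w.im, 2 * a.re - 1])) := by
    have e1 : w = w.re + w.im * Complex.I := (Complex.re_add_im w).symm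
    have e2 : (starRingEnd ℂ) w = w.re - w.im * Complex.I := by
      apply Complex.ext <;> simp
    ext i j
    fin_cases i <;> fin_cases j <;> simp [spin_eq, ← ha, ← hw, h01, h11, har, e2]
    · ring
    · linear_combination e1
    · ring
  refine ⟨WithLp.toLp 2 ![2 * w.re, 2 * w.im, 2 * a.re - 1], ?_, ?_⟩
  · rw [EuclideanSpace.norm_eq, Real.sqrt_eq_one]
    rw [det_fin_two, h01, h11, ← ha, ← hw, ← har, mul_comm _ w, Complex.mul_conj,
      Complex.normSq_apply] at hdet
    have : a.re * (1 - a.re) - (w.re * w.re + w.im * w.im) = 0 := by exact_mod_cast hdet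
    simp [Fin.sum_univ_three]
    linarith
  · funext k
    fin_cases k
    · exact hP0
    · have : P 1 = 1 - P 0 := eq_sub_of_add_eq' hP.sum_eq_one
      simp only [Fin.mk_one, spinMeasurement, cons_val_one, cons_val_zero, this, hP0]
      module

theorem disturbances_eq (ρ : Op) : disturbances ρ =
    {d | ∃ n : EuclideanSpace ℝ (Fin 3), ‖n‖ = 1 ∧
      d = traceNorm (ρ - measureA (spinMeasurement n) ρ)} := by
  ext d
  constructor
  · rintro ⟨P, hP, rfl⟩
    obtain ⟨n, hn, rfl⟩ := hP.exists_eq_spinMeasurement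
    exact ⟨n, hn, rfl⟩
  · rintro ⟨n, hn, rfl⟩
    exact ⟨_, spinMeasurement_isProjMeasurement hn, rfl⟩

theorem orthonormal_domRestrict_singleton {E ι : Type*} [NormedAddCommGroup E]
    [InnerProductSpace ℝ E] {n : E} (hn : ‖n‖ = 1) (k : ι) :
    Orthonormal ℝ (({k} : Set ι).domRestrict fun _ => n) :=
  ⟨fun _ => hn, fun i j hij => (hij (Subtype.ext (i.2.trans j.2.symm))).elim⟩

/-! ### The disturbance as a function of the direction -/

/-- The disturbance along `n` when `L₋` is `α + β |f⟩⟨f|` as a quadratic form. -/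
theorem traceNorm_sub_measureA {ρ : Op} (hρ : ρ.IsHermitian) {α β : ℝ}
    {f n : EuclideanSpace ℝ (Fin 3)} (hf : ‖f‖ = 1) (hn : ‖n‖ = 1)
    (hL : ∀ u v, inner ℝ (corrVec ρ u) (corrVec ρ v) - inner ℝ u (blochA ρ) * inner ℝ v (blochA ρ) =
      α * inner ℝ u v + β * (inner ℝ f u * inner ℝ f v)) :
    traceNorm (ρ - measureA (spinMeasurement n) ρ) =
      √(‖blochA ρ‖ ^ 2 - inner ℝ n (blochA ρ) ^ 2 + α
        + (β + |β|) / 2 * (1 - inner ℝ f n ^ 2)) := by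
  obtain ⟨b, hb⟩ := Orthonormal.exists_orthonormalBasis_extension_of_card_eq (𝕜 := ℝ)
    (E := EuclideanSpace ℝ (Fin 3)) (ι := Fin 3) (by simp) (v := fun _ => n) (s := {2})
    (orthonormal_domRestrict_singleton hn 2)
  obtain rfl : b 2 = n := hb 2 rfl
  have h1 : ∀ i, inner ℝ (b i) (b i) = 1 := fun i => by simp
  have hS : ∀ i, spin (b i) * spin (b i) = 1 := fun i => by rw [spin_mul_self, h1]; simp
  have h01 : inner ℝ (b 0) (b 1) = 0 := b.inner_eq_zero (by decide)
  have hST : spin (b 1) * spin (b 0) = -(spin (b 0) * spin (b 1)) := by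
    have := spin_mul_add_mul (b 1) (b 0)
    rw [real_inner_comm, h01] at this
    exact eq_neg_of_add_eq_zero_left (by simpa using this)
  rw [sub_measureA hρ b _ rfl rfl, coeffB, coeffB, traceNorm_of_anticommute (spin_isHermitian _)
    (spin_isHermitian _) (hS 0) (hS 1) hST]
  have hx := b.sum_sq_norm_inner_right (blochA ρ)
  have hfb := b.sum_sq_norm_inner_left f
  simp only [Fin.sum_univ_three, Real.norm_eq_abs, sq_abs, hf] at hx hfb
  have e00 := hL (b 0) (b 0)
  have e11 := hL (b 1) (b 1)
  have e01 := hL (b 0) (b 1)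
  rw [h1] at e00 e11
  rw [h01] at e01
  set p := inner ℝ f (b 0)
  set q := inner ℝ f (b 1)
  -- The radicand is the perfect square `β² ((p² - q²)² + 4 p² q²) = (β (p² + q²))²`; the scalar
  -- part `α` drops out of it.
  have hD : √(((inner ℝ (corrVec ρ (b 0)) (corrVec ρ (b 0)) - inner ℝ (b 0) (blochA ρ) ^ 2) -
      (inner ℝ (corrVec ρ (b 1)) (corrVec ρ (b 1)) - inner ℝ (b 1) (blochA ρ) ^ 2)) ^ 2
      + 4 * (inner ℝ (corrVec ρ (b 0)) (corrVec ρ (b 1)) -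
        inner ℝ (b 0) (blochA ρ) * inner ℝ (b 1) (blochA ρ)) ^ 2) = |β| * (p ^ 2 + q ^ 2) := by
    rw [sq (inner ℝ (b 0) (blochA ρ)), sq (inner ℝ (b 1) (blochA ρ)), e00, e11, e01,
      ← abs_of_nonneg (show 0 ≤ p ^ 2 + q ^ 2 by positivity), ← abs_mul, ← Real.sqrt_sq_eq_abs]
    congr 1
    ring
  rw [hD]
  congr 1
  linear_combination (e00 + e11) / 2 + hx + (β + |β|) / 2 * hfb

theorem isLeast_discord {ρ : Op} {d : ℝ} (h : IsLeast (disturbances ρ) d) :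
    IsLeast (disturbances ρ) (discord ρ) ∧ discord ρ = d := by
  have : discord ρ = d := h.csInf_eq
  exact ⟨this ▸ h, this⟩

theorem inner_corrVec (ρ : Op) (u v : EuclideanSpace ℝ (Fin 3)) :
    inner ℝ (corrVec ρ u) (corrVec ρ v) - inner ℝ u (blochA ρ) * inner ℝ v (blochA ρ) =
      inner ℝ u (toEuclideanLin (Lminus ρ) v) := by
  simp only [PiLp.inner_apply, corrVec, Lminus, Fin.sum_univ_three, toLpLin_apply, mulVec,
    dotProduct, transpose_apply, Matrix.sub_apply, mul_apply, vecMulVec_apply, RCLike.inner_apply,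
    conj_trivial]
  ring

/-- Spectral decomposition of the form of `L₋`, from which a repeated eigenvalue yields the shape `α
+ β |f⟩⟨f|`. -/
theorem inner_eq_sum_eigen {ρ : Op} {lam : Fin 3 → ℝ}
    {e : OrthonormalBasis (Fin 3) ℝ (EuclideanSpace ℝ (Fin 3))}
    (he : ∀ i, toEuclideanLin (Lminus ρ) (e i) = lam i • e i) (u v : EuclideanSpace ℝ (Fin 3)) :
    inner ℝ (corrVec ρ u) (corrVec ρ v) - inner ℝ u (blochA ρ) * inner ℝ v (blochA ρ) =
      ∑ i, lam i * (inner ℝ (e i) u * inner ℝ (e i) v) := by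
  rw [inner_corrVec]
  conv_lhs => rw [← e.sum_repr' v]
  simp only [map_sum, map_smul, he, inner_sum, inner_smul_right]
  refine Finset.sum_congr rfl fun i _ => ?_
  rw [real_inner_comm u]
  ring

/-! ### Maximising quadratic forms on the unit sphere -/

theorem binary_form_le (A B D c s : ℝ) : A * c ^ 2 + 2 * B * (c * s) + D * s ^ 2 ≤
    (A + D + √((A - D) ^ 2 + 4 * B ^ 2)) / 2 * (c ^ 2 + s ^ 2) := by
  have h : (A - D) * (c ^ 2 - s ^ 2) + 4 * B * (c * s) ≤
      √((A - D) ^ 2 + 4 * B ^ 2) * (c ^ 2 + s ^ 2) := by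
    rw [← Real.sqrt_sq (show 0 ≤ c ^ 2 + s ^ 2 by positivity), ← Real.sqrt_mul (by positivity)]
    apply Real.le_sqrt_of_sq_le
    -- Lagrange's identity for the vectors `(A - D, 2B)` and `(c² - s², 2cs)`, the second of length
    -- `c² + s²`.
    linarith [sq_nonneg ((A - D) * (2 * (c * s)) - 2 * B * (c ^ 2 - s ^ 2))]
  linarith

theorem exists_binary_form_eq (A B D : ℝ) : ∃ c s : ℝ, c ^ 2 + s ^ 2 = 1 ∧
    A * c ^ 2 + 2 * B * (c * s) + D * s ^ 2 = (A + D + √((A - D) ^ 2 + 4 * B ^ 2)) / 2 := by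
  set z : ℂ := ⟨A - D, 2 * B⟩ with hz
  have hnorm : ‖z‖ = √((A - D) ^ 2 + 4 * B ^ 2) := by
    rw [Complex.norm_def, Complex.normSq_apply]
    congr 1
    simp only [hz]
    ring
  have hre := Complex.norm_mul_cos_arg z
  have him := Complex.norm_mul_sin_arg z
  -- The form depends on the doubled angle, so the maximiser sits at half the argument of `(A - D) +
  -- 2B i`.
  set θ := z.arg / 2 with hθ
  rw [show z.arg = 2 * θ by rw [hθ]; ring] at hre him
  rw [Real.cos_two_mul] at hre
  rw [Real.sin_two_mul] at him
  simp only [hz] at hre him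
  rw [← hz] at hre him
  refine ⟨Real.cos θ, Real.sin θ, Real.cos_sq_add_sin_sq θ, ?_⟩
  rw [← hnorm]
  have h1 := Real.cos_sq_add_sin_sq θ
  generalize Real.cos θ = c at *
  generalize Real.sin θ = s at *
  generalize ‖z‖ = R at *
  have hs : s ^ 2 = 1 - c ^ 2 := by linarith
  have hA : A = R * (2 * c ^ 2 - 1) + D := by linarith
  have hB : B = R * (c * s) := by linarith
  rw [hA, hB]
  linear_combination (2 * R * c ^ 2 + D) * hs

/-- The largest value of the form `Δ ⟨f, n⟩² + ⟨n, x⟩²` on the unit sphere. -/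
theorem exists_max_rank_two {Δ : ℝ} (x f : EuclideanSpace ℝ (Fin 3)) (hf : ‖f‖ = 1)
    {m : ℝ} (hm : m = (Δ + ‖x‖ ^ 2 + √((Δ - ‖x‖ ^ 2) ^ 2 + 4 * Δ * inner ℝ f x ^ 2)) / 2)
    (hΔ : 0 < Δ) :
    (∀ n : EuclideanSpace ℝ (Fin 3), ‖n‖ = 1 → Δ * inner ℝ f n ^ 2 + inner ℝ n x ^ 2 ≤ m) ∧
      ∃ n : EuclideanSpace ℝ (Fin 3), ‖n‖ = 1 ∧ Δ * inner ℝ f n ^ 2 + inner ℝ n x ^ 2 = m := by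
  -- The form only sees the plane of `f` and `x`. If `x` is a multiple of `f`, any unit `g`
  -- orthogonal to `f` serves, with `r = 0`.
  obtain ⟨g, r, hg, hfg, hx⟩ : ∃ (g : EuclideanSpace ℝ (Fin 3)) (r : ℝ), ‖g‖ = 1 ∧
      inner ℝ f g = 0 ∧ x = inner ℝ f x • f + r • g := by
    have hff : inner ℝ f f = 1 := by rw [real_inner_self_eq_norm_sq, hf]; norm_num
    rcases eq_or_ne (x - inner ℝ f x • f) 0 with hy | hy
    · obtain ⟨b, hb⟩ := Orthonormal.exists_orthonormalBasis_extension_of_card_eq (𝕜 := ℝ)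
        (E := EuclideanSpace ℝ (Fin 3)) (ι := Fin 3) (by simp) (v := fun _ => f) (s := {2})
        (orthonormal_domRestrict_singleton hf 2)
      refine ⟨b 0, 0, b.norm_eq_one 0, ?_, ?_⟩
      · rw [← hb 2 rfl]
        exact b.inner_eq_zero (by decide)
      · rw [zero_smul, add_zero]
        exact sub_eq_zero.1 hy
    · have hy' := norm_ne_zero_iff.2 hy
      refine ⟨‖x - inner ℝ f x • f‖⁻¹ • (x - inner ℝ f x • f), ‖x - inner ℝ f x • f‖, ?_, ?_, ?_⟩
      · rw [norm_smul, norm_inv, norm_norm, inv_mul_cancel₀ hy']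
      · rw [inner_smul_right, inner_sub_right, inner_smul_right, hff]
        ring
      · rw [smul_smul, mul_inv_cancel₀ hy', one_smul]
        abel
  set ξ := inner ℝ f x with hξ
  have hff : inner ℝ f f = 1 := by rw [real_inner_self_eq_norm_sq, hf]; norm_num
  have hgg : inner ℝ g g = 1 := by rw [real_inner_self_eq_norm_sq, hg]; norm_num
  have hgf : inner ℝ g f = 0 := by rw [real_inner_comm, hfg]
  have hxx : ‖x‖ ^ 2 = ξ ^ 2 + r ^ 2 := by
    rw [← real_inner_self_eq_norm_sq, hx]
    simp only [inner_add_left, inner_add_right, inner_smul_left, inner_smul_right, hff, hgg, hfg,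
      hgf, conj_trivial]
    ring
  have hm' : m = ((Δ + ξ ^ 2) + r ^ 2 + √(((Δ + ξ ^ 2) - r ^ 2) ^ 2 + 4 * (ξ * r) ^ 2)) / 2 := by
    rw [hm, hxx]
    ring_nf
  have hval : ∀ n, Δ * inner ℝ f n ^ 2 + inner ℝ n x ^ 2 = (Δ + ξ ^ 2) * inner ℝ f n ^ 2 +
      2 * (ξ * r) * (inner ℝ f n * inner ℝ g n) + r ^ 2 * inner ℝ g n ^ 2 := by
    intro n
    have : inner ℝ n x = ξ * inner ℝ f n + r * inner ℝ g n := by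
      conv_lhs => rw [hx]
      rw [inner_add_right, inner_smul_right, inner_smul_right, real_inner_comm n, real_inner_comm n]
    rw [this]
    ring
  constructor
  · intro n hn
    -- Bessel's inequality. As `m ≥ 0`, the bound `m` times this sum is at most `m`.
    have hb : inner ℝ f n ^ 2 + inner ℝ g n ^ 2 ≤ 1 := by
      have h := real_inner_self_nonneg (x := n - inner ℝ f n • f - inner ℝ g n • g)
      simp only [inner_sub_left, inner_sub_right, inner_smul_left, inner_smul_right, hff, hgg, hfg,
        hgf, conj_trivial, real_inner_self_eq_norm_sq n, hn, real_inner_comm f n,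
        real_inner_comm g n] at h
      linarith
    rw [hval]
    refine (binary_form_le _ _ _ _ _).trans ?_
    rw [← hm']
    have hm0 : 0 ≤ m := by rw [hm]; positivity
    nlinarith
  · obtain ⟨c, s, hcs, h⟩ := exists_binary_form_eq (Δ + ξ ^ 2) (ξ * r) (r ^ 2)
    refine ⟨c • f + s • g, ?_, ?_⟩
    · rw [← sq_eq_sq₀ (norm_nonneg _) zero_le_one, ← real_inner_self_eq_norm_sq]
      simp only [inner_add_left, inner_add_right, inner_smul_left, inner_smul_right, hff, hgg, hfg,
        hgf, conj_trivial]
      linarith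
    · rw [hval, hm', ← h]
      simp only [inner_add_right, inner_smul_right, hff, hgg, hfg, hgf]
      ring

end TwoQubit

open TwoQubit

/-! ### The two degenerate cases -/

theorem mainTheorem2 (ρ : TwoQubit.Op) (hρ : TwoQubit.IsState ρ)
    (lam : Fin 3 → ℝ) (e : OrthonormalBasis (Fin 3) ℝ (EuclideanSpace ℝ (Fin 3)))
    (hlam : lam 0 ≥ lam 1 ∧ lam 1 ≥ lam 2)
    (he : ∀ i, Matrix.toEuclideanLin (TwoQubit.Lminus ρ) (e i) = lam i • e i) :
    (lam 0 = lam 1 →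
      IsLeast (TwoQubit.disturbances ρ) (TwoQubit.discord ρ) ∧
      TwoQubit.discord ρ = √(lam 1)) ∧
    (lam 0 > lam 1 → lam 1 = lam 2 →
      IsLeast (TwoQubit.disturbances ρ) (TwoQubit.discord ρ) ∧
      TwoQubit.discord ρ =
        1 / √2 * √(lam 0 + lam 1 + ‖TwoQubit.blochA ρ‖ ^ 2
          - √((lam 0 - lam 1 - ‖TwoQubit.blochA ρ‖ ^ 2) ^ 2
              + 4 * (lam 0 - lam 1) * (inner ℝ (e 0) (TwoQubit.blochA ρ)) ^ 2))) := by
  have hH := hρ.posSemidef.isHermitian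
  have hsum := inner_eq_sum_eigen he
  have hexp : ∀ u v : EuclideanSpace ℝ (Fin 3), inner ℝ u v =
      ∑ i, inner ℝ (e i) u * inner ℝ (e i) v := by
    intro u v
    rw [← e.sum_inner_mul_inner u v]
    exact Finset.sum_congr rfl fun i _ => by rw [real_inner_comm]
  simp only [Fin.sum_univ_three] at hsum hexp
  constructor
  · intro h01
    have hd : ∀ n : EuclideanSpace ℝ (Fin 3), ‖n‖ = 1 →
        traceNorm (ρ - measureA (spinMeasurement n) ρ) =
          √(lam 1 + (‖blochA ρ‖ ^ 2 - inner ℝ n (blochA ρ) ^ 2)) := by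
      intro n hn
      -- Here `β ≤ 0`, so `β + |β| = 0` and the dependence on `e 2` vanishes.
      rw [traceNorm_sub_measureA (α := lam 1) (β := lam 2 - lam 1) hH (e.norm_eq_one 2) hn]
      · rw [abs_of_nonpos (by linarith [hlam.2])]
        congr 1
        ring
      · intro u v
        rw [hsum, hexp u v, h01]
        ring
    apply isLeast_discord
    rw [disturbances_eq]
    constructor
    · obtain ⟨n, hn, hnx⟩ : ∃ n : EuclideanSpace ℝ (Fin 3), ‖n‖ = 1 ∧
          inner ℝ n (blochA ρ) ^ 2 = ‖blochA ρ‖ ^ 2 := by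
        rcases eq_or_ne (blochA ρ) 0 with hx | hx
        · exact ⟨e 0, e.norm_eq_one 0, by simp [hx]⟩
        · have hx' := norm_ne_zero_iff.2 hx
          refine ⟨‖blochA ρ‖⁻¹ • blochA ρ, ?_, ?_⟩
          · rw [norm_smul, norm_inv, norm_norm, inv_mul_cancel₀ hx']
          · rw [real_inner_smul_left, real_inner_self_eq_norm_sq]
            field_simp
      exact ⟨n, hn, by rw [hd n hn, hnx, sub_self, add_zero]⟩
    · rintro _ ⟨n, hn, rfl⟩
      rw [hd n hn]
      apply Real.sqrt_le_sqrt
      have h := sq_le_sq' (neg_le_of_abs_le (abs_real_inner_le_norm n (blochA ρ)))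
        (real_inner_le_norm n (blochA ρ))
      rw [hn, one_mul] at h
      linarith
  · intro h01 h12
    have hd : ∀ n : EuclideanSpace ℝ (Fin 3), ‖n‖ = 1 →
        traceNorm (ρ - measureA (spinMeasurement n) ρ) =
          √(lam 0 + ‖blochA ρ‖ ^ 2 -
            ((lam 0 - lam 1) * inner ℝ (e 0) n ^ 2 + inner ℝ n (blochA ρ) ^ 2)) := by
      intro n hn
      rw [traceNorm_sub_measureA (α := lam 1) (β := lam 0 - lam 1) hH (e.norm_eq_one 0) hn]
      · rw [abs_of_pos (by linarith)]
        congr 1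
        ring
      · intro u v
        rw [hsum, hexp u v, ← h12]
        ring
    -- The disturbance decreases in this form, so its maximiser attains the minimum.
    obtain ⟨hle, n, hn, hmax⟩ := exists_max_rank_two (Δ := lam 0 - lam 1) (blochA ρ) (e 0)
      (e.norm_eq_one 0) rfl (sub_pos.2 h01)
    apply isLeast_discord
    rw [disturbances_eq, one_div, ← Real.sqrt_inv, ← Real.sqrt_mul (by norm_num)]
    constructor
    · refine ⟨n, hn, ?_⟩
      rw [hd n hn, hmax]
      congr 1
      ring
    · rintro _ ⟨n, hn, rfl⟩
      rw [hd n hn]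
      apply Real.sqrt_le_sqrt
      linarith [hle n hn]
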